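/- Let $1<n_1<n_2<n_3$ be integers, let $A_1,A_2,A_3\in\mathbb R[t]$ be nonzero polynomials, and consider the equation $$x'=A_3(t)x^{n_3}+A_2(t)x^{n_2}+A_1(t)x^{n_1}.\qquad (*)$$ Put $a_i=\deg A_i$ and let $\alpha_i$ be the leading coefficient of $A_i$ ($i=1,2,3$); put also $a_\partial=-1$, $n_\partial=1$. For $r\in\mathbb N_{>0}$ and $\ell\in\{3,2,1,\partial\}$ let $\Phi_\ell(r)=n_\ell r-a_\ell$, and let $T_r\subset\{3,2,1,\partial\}$ be the set of those $\ell$ at which $\Phi_\ell(r)$ is minimal. Call $r$ edge-admissible if $|T_r|\ge 2$, and let $$P_r(C)=\sum_{\ell\in T_r\cap\{3,2,1\}}\alpha_\ell C^{n_\ell}+\mathbf 1_{\{\partial\in T_r\}}\,rC,\qquad \widetilde P_r(C)=P_r(C)/C^{e_r},$$ where $e_r$ is the multiplicity of $0$ as a root of $P_r$. Let $\Gamma$ be the set of positive integers $r\le a_3/(n_3-n_2)$ of the form $r=\frac{a_i-a_j}{n_i-n_j}$ with $i\ne j$ in $\{3,2,1,\partial\}$. Assume the nondegeneracy hypothesis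 (ND): for every edge-admissible $r\in\Gamma$, - (ND1) $\operatorname{Res}_C(\widetilde P_r(C),\widetilde P_r'(C))\ne 0$; - (ND2) if $\partial\in T_r$, then $P_r'(C)$ is not a negative integer for any nonzero real root $C$ of $P_r$; - (ND3) if at least one of $n_3-n_2$, $n_3-n_1$, $n_3-1$ is even, then $\operatorname{Res}_C(\widetilde P_r(C),\widetilde P_r(-C))\neq 0$. Let $\mathcal S$ be the number of nonconstant rational solutions $x\in\mathbb R(t)$ of $(*)$, and assume $\mathcal S\ge 2$. Let $\Gamma_{\mathrm{sol}}$ be the set of all $\deg p$, where $p\in\mathbb R[t]$ and $x=1/p$ is a nonconstant solution of $(*)$. Then $\Gamma_{\mathrm{sol}}$ has a greatest element $r$. Consider the alternatives - (C1) $a_1<(n_1-1)r-1$ and $a_2=(n_2-1)r-1$; - (C2) $a_1>(n_1-1)r-1$ and $a_2=a_1+(n_2-n_1)r$; - (C3) $a_1=(n_1-1)r-1$ and $a_2\le(n_2-1)r-1$. The following bounds hold: (a) If (C1) holds, then $T_r=\{3,2,\partial\}$ and $\mathcal S\le 4$. (b) If (C2) holds and $T_r=\{2,1\}$, then $\mathcal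 S\le 5$. (c) If (C2) holds and $T_r=\{3,2,1\}$, then $\mathcal S\le 4$. (d) If (C3) holds and $T_r=\{2,1,\partial\}$, then $\mathcal S\le 12$. (e) If (C3) holds and $T_r=\{3,1,\partial\}$, then $\mathcal S\le 4$. (f) If (C3) holds and $T_r=\{3,2,1,\partial\}$, then $\mathcal S\le 5$. In particular, $\mathcal S\le 12$ in all cases. -/

import Mathlib

open Polynomial

/-- Formal derivative of a rational function `x = u / v` (in lowest terms): `(u' v - u v') / v²`. -/
noncomputable def ratDeriv (x : RatFunc ℝ) : RatFunc ℝ :=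
  algebraMap ℝ[X] (RatFunc ℝ)
      (derivative x.num * x.denom - x.num * derivative x.denom) /
    algebraMap ℝ[X] (RatFunc ℝ) x.denom ^ 2

/-- The quotient rule holds for every representation of a rational function as a fraction. -/
theorem ratDeriv_div (p q : ℝ[X]) (hq : q ≠ 0) :
    ratDeriv (algebraMap ℝ[X] (RatFunc ℝ) p / algebraMap ℝ[X] (RatFunc ℝ) q) =
      algebraMap ℝ[X] (RatFunc ℝ) (derivative p * q - p * derivative q) /
        algebraMap ℝ[X] (RatFunc ℝ) q ^ 2 := by
  generalize hx : algebraMap ℝ[X] (RatFunc ℝ) p / algebraMap ℝ[X] (RatFunc ℝ) q = x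
  have h1 : x.num * q = p * x.denom := (RatFunc.num_mul_eq_mul_denom_iff hq).mpr hx.symm
  have hv : x.denom ≠ 0 := RatFunc.denom_ne_zero x
  unfold ratDeriv
  generalize x.num = u at *
  generalize x.denom = v at *
  have hv' : algebraMap ℝ[X] (RatFunc ℝ) v ≠ 0 := RatFunc.algebraMap_ne_zero hv
  have hq' : algebraMap ℝ[X] (RatFunc ℝ) q ≠ 0 := RatFunc.algebraMap_ne_zero hq
  have h2 : derivative u * q + u * derivative q =
      derivative p * v + p * derivative v := by
    rw [← derivative_mul, ← derivative_mul, h1]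
  have h3 : (derivative u * v - u * derivative v) * q ^ 2 =
      (derivative p * q - p * derivative q) * v ^ 2 := by
    linear_combination v * q * h2 - (v * derivative q + q * derivative v) * h1
  rw [div_eq_div_iff (pow_ne_zero 2 hv') (pow_ne_zero 2 hq'), ← map_pow, ← map_pow,
    ← map_mul, ← map_mul, h3]

/-- A real three-term generalized Abel equation
`x' = A₃(t) x ^ n₃ + A₂(t) x ^ n₂ + A₁(t) x ^ n₁` with nonzero polynomial coefficients and
`1 < n₁ < n₂ < n₃`. -/
structure AbelEquation where
  n₁ : ℕ
  n₂ : ℕ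
  n₃ : ℕ
  A₁ : ℝ[X]
  A₂ : ℝ[X]
  A₃ : ℝ[X]
  one_lt_n₁ : 1 < n₁
  n₁_lt_n₂ : n₁ < n₂
  n₂_lt_n₃ : n₂ < n₃
  A₁_ne_zero : A₁ ≠ 0
  A₂_ne_zero : A₂ ≠ 0
  A₃_ne_zero : A₃ ≠ 0

/-- The four labels `3, 2, 1, ∂` (`der` stands for `∂`). -/
inductive Vertex where
  | three : Vertex
  | two : Vertex
  | one : Vertex
  | der : Vertex
  deriving DecidableEq

instance : Fintype Vertex where
  elems := {.three, .two, .one, .der}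
  complete := by intro l; cases l <;> decide

namespace AbelEquation

/-- The exponents `n₃, n₂, n₁`, with the convention `n_∂ = 1`. -/
def n (E : AbelEquation) : Vertex → ℕ
  | .three => E.n₃
  | .two => E.n₂
  | .one => E.n₁
  | .der => 1

/-- The degrees `a_i = deg A_i`, with the convention `a_∂ = -1`. -/
noncomputable def a (E : AbelEquation) : Vertex → ℤ
  | .three => E.A₃.natDegree
  | .two => E.A₂.natDegree
  | .one => E.A₁.natDegree
  | .der => -1

/-- The order `Φ_ℓ(r) = n_ℓ r - a_ℓ`; in particular `Φ_∂(r) = r + 1`. -/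
noncomputable def Phi (E : AbelEquation) (l : Vertex) (r : ℕ) : ℤ :=
  (E.n l : ℤ) * r - E.a l

open scoped Classical in
/-- The tie set `T_r`: the labels at which the minimum of `Φ_ℓ(r)` is attained. -/
noncomputable def T (E : AbelEquation) (r : ℕ) : Finset Vertex :=
  Finset.univ.filter fun l => ∀ k, E.Phi l r ≤ E.Phi k r

/-- `r` is edge-admissible: `r > 0` and the minimum is attained at least twice. -/
def EdgeAdmissible (E : AbelEquation) (r : ℕ) : Prop :=
  0 < r ∧ 2 ≤ (E.T r).card

/-- The term contributed by each label to the edge polynomial: `α_i C ^ n_i` for `i = 3, 2, 1`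
(`α_i` the leading coefficient of `A_i`), and `r C` for `∂`. -/
noncomputable def edgeTerm (E : AbelEquation) (r : ℕ) : Vertex → ℝ[X]
  | .three => C E.A₃.leadingCoeff * X ^ E.n₃
  | .two => C E.A₂.leadingCoeff * X ^ E.n₂
  | .one => C E.A₁.leadingCoeff * X ^ E.n₁
  | .der => C (r : ℝ) * X

/-- The edge polynomial `P_r`. -/
noncomputable def P (E : AbelEquation) (r : ℕ) : ℝ[X] :=
  ∑ l ∈ E.T r, E.edgeTerm r l

/-- `P_r` divided by the largest power of the variable that divides it. -/
noncomputable def Ptilde (E : AbelEquation) (r : ℕ) : ℝ[X] :=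
  E.P r /ₘ X ^ (E.P r).rootMultiplicity 0

/-- The tie values `r_{ij} = (a_i - a_j) / (n_i - n_j)` (used for `i ≠ j` only, where the `n_i` are
distinct). -/
noncomputable def tieValue (E : AbelEquation) (i j : Vertex) : ℚ :=
  ((E.a i : ℚ) - E.a j) / ((E.n i : ℚ) - E.n j)

/-- The set `Γ` of candidate degrees: positive integers `r ≤ a₃ / (n₃ - n₂)` equal to one of the
six tie values. -/
def Gam (E : AbelEquation) : Set ℕ :=
  {r | 0 < r ∧ (r : ℚ) ≤ (E.A₃.natDegree : ℚ) / ((E.n₃ : ℚ) - E.n₂) ∧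
    ∃ i j, i ≠ j ∧ (r : ℚ) = E.tieValue i j}

/-- Simple roots: the resultant of `P̃_r` and its derivative is nonzero. -/
def ND1 (E : AbelEquation) (r : ℕ) : Prop :=
  resultant (E.Ptilde r) (derivative (E.Ptilde r)) ≠ 0

/-- Nonresonance: if `∂ ∈ T_r`, then `P_r'(c)` is not a negative integer at any nonzero real root
`c` of `P_r`. -/
def ND2 (E : AbelEquation) (r : ℕ) : Prop :=
  Vertex.der ∈ E.T r → ∀ c : ℝ, c ≠ 0 → (E.P r).eval c = 0 →
    ∀ m : ℤ, m < 0 → (derivative (E.P r)).eval c ≠ (m : ℝ)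

/-- Root-of-unity separation over the reals: if one of `n₃ - n₂`, `n₃ - n₁`, `n₃ - 1` is even, then
the resultant of `P̃_r(C)` and `P̃_r(-C)` is nonzero. -/
def ND3 (E : AbelEquation) (r : ℕ) : Prop :=
  (Even (E.n₃ - E.n₂) ∨ Even (E.n₃ - E.n₁) ∨ Even (E.n₃ - 1)) →
    resultant (E.Ptilde r) ((E.Ptilde r).comp (-X)) ≠ 0

/-- The nondegeneracy hypothesis (ND), over the reals. -/
def ND (E : AbelEquation) : Prop :=
  ∀ r ∈ E.Gam, E.EdgeAdmissible r → E.ND1 r ∧ E.ND2 r ∧ E.ND3 r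

/-- The set of nonconstant rational solutions. -/
def solutions (E : AbelEquation) : Set (RatFunc ℝ) :=
  {x | (¬ ∃ c : ℝ, x = RatFunc.C c) ∧
    ratDeriv x = algebraMap ℝ[X] (RatFunc ℝ) E.A₃ * x ^ E.n₃ +
      algebraMap ℝ[X] (RatFunc ℝ) E.A₂ * x ^ E.n₂ +
      algebraMap ℝ[X] (RatFunc ℝ) E.A₁ * x ^ E.n₁}

/-- The number `𝒮` of nonconstant rational solutions. -/
noncomputable def S (E : AbelEquation) : ℕ∞ := E.solutions.encard

/-- The set `Γ_sol` of realized denominator degrees: all `deg p` such that `1 / p` is a nonconstant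
rational solution. -/
def GamSol (E : AbelEquation) : Set ℕ :=
  {d | ∃ p : ℝ[X], (algebraMap ℝ[X] (RatFunc ℝ) p)⁻¹ ∈ E.solutions ∧ p.natDegree = d}

/-- Alternative (C1) at degree `d`: `a₁ < (n₁ - 1) d - 1` and `a₂ = (n₂ - 1) d - 1`. -/
def C1 (E : AbelEquation) (d : ℕ) : Prop :=
  (E.A₁.natDegree : ℤ) < ((E.n₁ : ℤ) - 1) * d - 1 ∧
    (E.A₂.natDegree : ℤ) = ((E.n₂ : ℤ) - 1) * d - 1

/-- Alternative (C2) at degree `d`: `a₁ > (n₁ - 1) d - 1` and `a₂ = a₁ + (n₂ - n₁) d`. -/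
def C2 (E : AbelEquation) (d : ℕ) : Prop :=
  (E.A₁.natDegree : ℤ) > ((E.n₁ : ℤ) - 1) * d - 1 ∧
    (E.A₂.natDegree : ℤ) = E.A₁.natDegree + ((E.n₂ : ℤ) - E.n₁) * d

/-- Alternative (C3) at degree `d`: `a₁ = (n₁ - 1) d - 1` and `a₂ ≤ (n₂ - 1) d - 1`. -/
def C3 (E : AbelEquation) (d : ℕ) : Prop :=
  (E.A₁.natDegree : ℤ) = ((E.n₁ : ℤ) - 1) * d - 1 ∧
    (E.A₂.natDegree : ℤ) ≤ ((E.n₂ : ℤ) - 1) * d - 1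

end AbelEquation

/-! A nonconstant rational solution is `1 / p` with `p` a polynomial satisfying `A₃ + A₂ p^(n₃-n₂) +
A₁ p^(n₃-n₁) + p' p^(n₃-2) = 0` (`mem_solutions_iff`). With `r = deg p`, the top coefficient of this
identity says that the inverse leading coefficient of `p` is a nonzero real root of `P_r`.
Linearizing at that root, (ND1) and (ND2) show that `p` is determined by its degree and leading
coefficient (`IsDenominator.eq_of_leadingCoeff_eq`). So Descartes' rule of signs applied to `P_r`
bounds the solutions of each degree.

Subtracting the identities of two solutions removes `A₃`; with (ND3) the three remaining top degrees
must then tie, which gives (C1)–(C3) (`IsDenominator.alternatives`).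

Smaller degrees are controlled by the slopes `n_ℓ` of `Φ_ℓ`. If `3 ∈ T_r` for the greatest degree
`r`, no smaller degree is admissible; if `2 ∈ T_r`, at most one smaller degree occurs, with tie set
`{3, 2}` and at most two solutions. The resulting bounds are 4 for `{2, 1}` and 6 for `{2, 1, ∂}`,
sharper than the 5 and 12 claimed. -/

theorem resultant_eq_zero_of_common_root {f g : ℝ[X]} (hf : f ≠ 0) {c : ℝ}
    (hfc : f.eval c = 0) (hgc : g.eval c = 0) : resultant f g = 0 := by
  obtain ⟨h, rfl⟩ := dvd_iff_isRoot.mpr hfc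
  have hh : h ≠ 0 := right_ne_zero_of_mul hf
  rw [natDegree_mul (X_sub_C_ne_zero c) hh, resultant_mul_left _ _ _ _ le_rfl,
    natDegree_X_sub_C, resultant_X_sub_C_left _ _ _ le_rfl, hgc, zero_mul]

/-! ### Descartes' rule of signs for sparse polynomials -/

/-- The number of sign variations of `f(x)` plus the number of sign variations of `f(-x)`. -/
noncomputable def twoSidedVariations (f : ℝ[X]) : ℕ :=
  signVariations f + signVariations (f.comp (-X))

theorem encard_pos_roots_le (f : ℝ[X]) (hf : f ≠ 0) :
    {x : ℝ | 0 < x ∧ f.eval x = 0}.encard ≤ signVariations f := by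
  have h : {x : ℝ | 0 < x ∧ f.eval x = 0} =
      ((f.roots.filter (0 < ·)).toFinset : Set ℝ) := by
    ext x
    simp [hf, and_comm]
  rw [h, Set.encard_coe_eq_coe_finsetCard]
  have h1 := roots_countP_pos_le_signVariations f
  rw [Multiset.countP_eq_card_filter] at h1
  exact_mod_cast (Multiset.toFinset_card_le _).trans h1

theorem comp_neg_X_ne_zero {f : ℝ[X]} (hf : f ≠ 0) : f.comp (-X) ≠ 0 := by
  intro h
  apply hf
  have := congrArg (fun g : ℝ[X] => g.comp (-X)) h
  simpa [comp_assoc] using this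

theorem encard_nonzero_roots_le (f : ℝ[X]) (hf : f ≠ 0) :
    {x : ℝ | x ≠ 0 ∧ f.eval x = 0}.encard ≤ twoSidedVariations f := by
  have hsub : {x : ℝ | x ≠ 0 ∧ f.eval x = 0} ⊆ {x : ℝ | 0 < x ∧ f.eval x = 0} ∪
      (fun x : ℝ => -x) '' {x : ℝ | 0 < x ∧ (f.comp (-X)).eval x = 0} := by
    rintro x ⟨hx, hfx⟩
    rcases lt_or_gt_of_ne hx with h | h
    · exact Or.inr ⟨-x, ⟨by linarith, by simpa using hfx⟩, by simp⟩
    · exact Or.inl ⟨h, hfx⟩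
  refine (Set.encard_le_encard hsub).trans ((Set.encard_union_le _ _).trans ?_)
  rw [twoSidedVariations]
  push_cast
  exact add_le_add (encard_pos_roots_le f hf)
    ((Set.encard_image_le _ _).trans (encard_pos_roots_le _ (comp_neg_X_ne_zero hf)))

/-- The case `g = 0` needs no exception: its leading sign is `0`, which `sign α` never matches. -/
theorem signVariations_leading_add {α : ℝ} (hα : α ≠ 0) {a : ℕ} {g : ℝ[X]}
    (hga : g.natDegree < a) :
    signVariations (C α * X ^ a + g) = signVariations g +
      if SignType.sign α = -SignType.sign g.leadingCoeff then 1 else 0 := by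
  have hd : g.natDegree < (C α * X ^ a).natDegree := by
    rwa [natDegree_C_mul_X_pow _ _ hα]
  have hne : C α * X ^ a + g ≠ 0 := by
    intro h
    have := congrArg (fun p : ℝ[X] => p.coeff a) h
    simp [coeff_eq_zero_of_natDegree_lt hga, hα] at this
  rw [signVariations_eq_eraseLead_add_ite hne, eraseLead_add_of_natDegree_lt_left hd,
    eraseLead_C_mul_X_pow, zero_add,
    leadingCoeff_add_of_degree_lt' (degree_lt_degree hd), leadingCoeff_C_mul_X_pow]

theorem leadingCoeff_comp_neg_X (g : ℝ[X]) :
    (g.comp (-X)).leadingCoeff = (-1) ^ g.natDegree * g.leadingCoeff := by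
  rw [leadingCoeff_comp (by simp)]
  simp [mul_comm]

theorem natDegree_comp_neg_X (g : ℝ[X]) : (g.comp (-X)).natDegree = g.natDegree := by
  simp [natDegree_comp]

theorem leading_add_comp_neg_X (α : ℝ) (a : ℕ) (g : ℝ[X]) :
    (C α * X ^ a + g).comp (-X) = C ((-1) ^ a * α) * X ^ a + g.comp (-X) := by
  simp only [add_comp, mul_comp, C_comp, pow_comp, X_comp, map_mul, map_pow, map_neg, map_one]
  rw [neg_pow]
  ring

theorem twoSidedVariations_leading_add_le {α : ℝ} (hα : α ≠ 0) {a : ℕ} {g : ℝ[X]}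
    (hga : g.natDegree < a) :
    twoSidedVariations (C α * X ^ a + g) ≤ twoSidedVariations g + 2 := by
  rw [twoSidedVariations, twoSidedVariations, leading_add_comp_neg_X,
    signVariations_leading_add hα hga,
    signVariations_leading_add (by simpa using hα) (by rwa [natDegree_comp_neg_X])]
  split_ifs <;> omega

/-- Across an odd gap, `x ↦ -x` reverses the relative sign of the two top terms, so only one of
`f(x)`, `f(-x)` can gain a variation. -/
theorem twoSidedVariations_leading_add_le_of_odd {α : ℝ} (hα : α ≠ 0) {a : ℕ} {g : ℝ[X]}
    (hg : g ≠ 0) (hga : g.natDegree < a) (hodd : Odd (a + g.natDegree)) :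
    twoSidedVariations (C α * X ^ a + g) ≤ twoSidedVariations g + 1 := by
  rw [twoSidedVariations, twoSidedVariations, leading_add_comp_neg_X,
    signVariations_leading_add hα hga,
    signVariations_leading_add (by simpa using hα) (by rwa [natDegree_comp_neg_X]),
    leadingCoeff_comp_neg_X]
  have key : ¬ (SignType.sign α = -SignType.sign g.leadingCoeff ∧
      SignType.sign ((-1) ^ a * α) =
        -SignType.sign ((-1) ^ g.natDegree * g.leadingCoeff)) := by
    rintro ⟨h1, h2⟩
    rw [sign_mul, sign_mul, h1] at h2
    rcases Nat.even_or_odd a with ha | ha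
    · have hb : Odd g.natDegree := by
        rcases Nat.even_or_odd g.natDegree with hb | hb
        · exact absurd hodd (by simpa using ha.add hb)
        · exact hb
      simp [ha.neg_one_pow, hb.neg_one_pow] at h2
      exact hg h2
    · have hb : Even g.natDegree := by
        rcases Nat.even_or_odd g.natDegree with hb | hb
        · exact hb
        · exact absurd hodd (by simpa using ha.add_odd hb)
      simp [ha.neg_one_pow, hb.neg_one_pow] at h2
      exact hg h2
  split_ifs with h1 h2
  · exact absurd ⟨h1, h2⟩ key
  all_goals omega

theorem twoSidedVariations_C_mul_X_pow (α : ℝ) (a : ℕ) :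
    twoSidedVariations (C α * X ^ a) = 0 := by
  have h := leading_add_comp_neg_X α a 0
  simp only [add_zero, zero_comp] at h
  rw [twoSidedVariations, h, C_mul_X_pow_eq_monomial, C_mul_X_pow_eq_monomial,
    signVariations_monomial, signVariations_monomial]

theorem natDegree_leading_add {α : ℝ} (hα : α ≠ 0) {a : ℕ} {g : ℝ[X]} (hga : g.natDegree < a) :
    (C α * X ^ a + g).natDegree = a := by
  rw [natDegree_add_eq_left_of_natDegree_lt] <;> simp [natDegree_C_mul_X_pow _ _ hα, hga]

theorem ne_zero_leading_add {α : ℝ} (hα : α ≠ 0) {a : ℕ} {g : ℝ[X]} (hga : g.natDegree < a) :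
    C α * X ^ a + g ≠ 0 := by
  intro h
  have := natDegree_leading_add hα hga
  rw [h, natDegree_zero] at this
  omega

theorem encard_nonzero_roots_binomial_le {α β : ℝ} (hα : α ≠ 0) (hβ : β ≠ 0) {a b : ℕ}
    (hab : b < a) :
    {x : ℝ | x ≠ 0 ∧ (C α * X ^ a + C β * X ^ b).eval x = 0}.encard ≤ 2 := by
  have hd : (C β * X ^ b).natDegree < a := by rwa [natDegree_C_mul_X_pow _ _ hβ]
  refine (encard_nonzero_roots_le _ (ne_zero_leading_add hα hd)).trans ?_
  have := twoSidedVariations_leading_add_le hα hd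
  rw [twoSidedVariations_C_mul_X_pow] at this
  exact_mod_cast this

theorem encard_nonzero_roots_trinomial_le {α β γ : ℝ} (hα : α ≠ 0) (hβ : β ≠ 0) (hγ : γ ≠ 0)
    {a b c : ℕ} (hab : b < a) (hbc : c < b) :
    {x : ℝ | x ≠ 0 ∧ (C α * X ^ a + (C β * X ^ b + C γ * X ^ c)).eval x = 0}.encard ≤ 4 := by
  have hd : (C γ * X ^ c).natDegree < b := by rwa [natDegree_C_mul_X_pow _ _ hγ]
  have hd' : (C β * X ^ b + C γ * X ^ c).natDegree < a := by rwa [natDegree_leading_add hβ hd]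
  refine (encard_nonzero_roots_le _ (ne_zero_leading_add hα hd')).trans ?_
  have h1 := twoSidedVariations_leading_add_le hβ hd
  have h2 := twoSidedVariations_leading_add_le hα hd'
  rw [twoSidedVariations_C_mul_X_pow] at h1
  exact_mod_cast (by omega : twoSidedVariations _ ≤ 4)

theorem encard_nonzero_roots_quadrinomial_le {α β γ δ : ℝ} (hα : α ≠ 0) (hβ : β ≠ 0)
    (hγ : γ ≠ 0) (hδ : δ ≠ 0) {a b c d : ℕ} (hab : b < a) (hbc : c < b) (hcd : d < c)
    (hodd : Odd (a + b) ∨ Odd (b + c) ∨ Odd (c + d)) :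
    {x : ℝ | x ≠ 0 ∧ (C α * X ^ a + (C β * X ^ b + (C γ * X ^ c + C δ * X ^ d))).eval x = 0}.encard
      ≤ 5 := by
  have hd : (C δ * X ^ d).natDegree < c := by rwa [natDegree_C_mul_X_pow _ _ hδ]
  have e1 := natDegree_leading_add hγ hd
  have hd' : (C γ * X ^ c + C δ * X ^ d).natDegree < b := by rwa [e1]
  have e2 := natDegree_leading_add hβ hd'
  have hd'' : (C β * X ^ b + (C γ * X ^ c + C δ * X ^ d)).natDegree < a := by rwa [e2]
  refine (encard_nonzero_roots_le _ (ne_zero_leading_add hα hd'')).trans ?_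
  have h1 := twoSidedVariations_leading_add_le hγ hd
  have h2 := twoSidedVariations_leading_add_le hβ hd'
  have h3 := twoSidedVariations_leading_add_le hα hd''
  rw [twoSidedVariations_C_mul_X_pow] at h1
  suffices h : twoSidedVariations
      (C α * X ^ a + (C β * X ^ b + (C γ * X ^ c + C δ * X ^ d))) ≤ 5 by exact_mod_cast h
  rcases hodd with h | h | h
  · have := twoSidedVariations_leading_add_le_of_odd hα (ne_zero_leading_add hβ hd') hd''
      (by rwa [e2])
    omega
  · have := twoSidedVariations_leading_add_le_of_odd hβ (ne_zero_leading_add hγ hd) hd'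
      (by rwa [e1])
    omega
  · have := twoSidedVariations_leading_add_le_of_odd hγ (by simpa using hδ) hd
      (by rwa [natDegree_C_mul_X_pow _ _ hδ])
    rw [twoSidedVariations_C_mul_X_pow] at this
    omega

/-- The first-order expansion of a power: to leading order, a perturbation of degree `j` is
multiplied by the derivative `(m + 1) p^m`. -/
theorem pow_sub_pow_natDegree_coeff {p q : ℝ[X]} {r j : ℕ} (hp : p.natDegree ≤ r)
    (hq : q.natDegree ≤ r) (hpq : p.coeff r = q.coeff r) (hs : (p - q).natDegree ≤ j) (m : ℕ) :
    (p ^ (m + 1) - q ^ (m + 1)).natDegree ≤ m * r + j ∧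
      (p ^ (m + 1) - q ^ (m + 1)).coeff (m * r + j) =
        (p - q).coeff j * ((m + 1) * p.coeff r ^ m) := by
  induction m with
  | zero => simpa using hs
  | succ m ih =>
    have e : p ^ (m + 1 + 1) - q ^ (m + 1 + 1) =
        p ^ (m + 1) * (p - q) + q * (p ^ (m + 1) - q ^ (m + 1)) := by ring
    have hpm : (p ^ (m + 1)).natDegree ≤ (m + 1) * r := natDegree_pow_le_of_le _ hp
    have hidx : (m + 1) * r + j = r + (m * r + j) := by ring
    constructor
    · rw [e]
      refine natDegree_add_le_of_degree_le (natDegree_mul_le_of_le hpm hs) ?_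
      rw [hidx]
      exact natDegree_mul_le_of_le hq ih.1
    · rw [e, coeff_add, coeff_mul_add_eq_of_natDegree_le hpm hs, hidx,
        coeff_mul_add_eq_of_natDegree_le hq ih.1, ih.2, coeff_pow_of_natDegree_le hp, ← hpq]
      push_cast
      ring

/-! ### The polynomial identity for denominators and its top coefficient -/

namespace AbelEquation

variable (E : AbelEquation)

/-- The coefficients `α₃, α₂, α₁, r` of the edge polynomial. -/
noncomputable def edgeCoeff (r : ℕ) : Vertex → ℝ
  | .three => E.A₃.leadingCoeff
  | .two => E.A₂.leadingCoeff
  | .one => E.A₁.leadingCoeff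
  | .der => r

theorem edgeTerm_eq (r : ℕ) (l : Vertex) :
    E.edgeTerm r l = C (E.edgeCoeff r l) * X ^ E.n l := by
  cases l <;> simp [edgeTerm, edgeCoeff, n]

theorem edgeCoeff_ne_zero {r : ℕ} (hr : 0 < r) (l : Vertex) : E.edgeCoeff r l ≠ 0 := by
  cases l
  · exact leadingCoeff_ne_zero.mpr E.A₃_ne_zero
  · exact leadingCoeff_ne_zero.mpr E.A₂_ne_zero
  · exact leadingCoeff_ne_zero.mpr E.A₁_ne_zero
  · simpa [edgeCoeff] using hr.ne'

theorem n_injective : Function.Injective E.n := by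
  have h1 := E.one_lt_n₁
  have h2 := E.n₁_lt_n₂
  have h3 := E.n₂_lt_n₃
  intro k l h
  cases k <;> cases l <;> simp only [n] at h <;> first | rfl | omega

theorem n_le (l : Vertex) : E.n l ≤ E.n₃ := by
  have h1 := E.one_lt_n₁
  have h2 := E.n₁_lt_n₂
  have h3 := E.n₂_lt_n₃
  cases l <;> simp only [n] <;> omega

theorem n_pos (l : Vertex) : 0 < E.n l := by
  have h1 := E.one_lt_n₁
  have h2 := E.n₁_lt_n₂
  have h3 := E.n₂_lt_n₃
  cases l <;> simp only [n] <;> omega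

/-- The degree at which the term `l` of the equation for a denominator of degree `r` is led. -/
noncomputable def topExp (r : ℕ) : Vertex → ℕ
  | .three => E.A₃.natDegree
  | .two => E.A₂.natDegree + (E.n₃ - E.n₂) * r
  | .one => E.A₁.natDegree + (E.n₃ - E.n₁) * r
  | .der => r - 1 + (E.n₃ - 2) * r

/-- Minimizing `Φ` thus means maximizing degree. Positivity of `r` keeps `r - 1` in the label `∂`
from truncating. -/
theorem topExp_cast {r : ℕ} (hr : 0 < r) (l : Vertex) :
    (E.topExp r l : ℤ) = E.n₃ * r - E.Phi l r := by
  have h1 := E.one_lt_n₁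
  have h2 := E.n₁_lt_n₂
  have h3 := E.n₂_lt_n₃
  cases l <;> simp only [topExp, Phi, n, a]
  · ring
  · push_cast [Nat.cast_sub h3.le]
    ring
  · push_cast [Nat.cast_sub (h2.trans h3).le]
    ring
  · push_cast [Nat.cast_sub (show 1 ≤ r from hr), Nat.cast_sub (show 2 ≤ E.n₃ by omega)]
    ring

theorem mem_T_iff (r : ℕ) (l : Vertex) : l ∈ E.T r ↔ ∀ k, E.Phi l r ≤ E.Phi k r := by
  simp [T]

theorem exists_topExp_max {r : ℕ} (hr : 0 < r) :
    ∃ M : ℕ, (∀ l, E.topExp r l ≤ M) ∧ (∀ l, l ∈ E.T r ↔ E.topExp r l = M) := by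
  obtain ⟨k, -, hk⟩ := Finset.exists_max_image Finset.univ (E.topExp r) ⟨Vertex.three, by simp⟩
  refine ⟨E.topExp r k, fun l => hk l (by simp), fun l => ?_⟩
  rw [mem_T_iff]
  constructor
  · intro h
    have h1 := h k
    have h2 := hk l (by simp)
    have h3 := E.topExp_cast hr k
    have h4 := E.topExp_cast hr l
    omega
  · intro h m
    have h2 := hk m (by simp)
    have h3 := E.topExp_cast hr m
    have h4 := E.topExp_cast hr l
    omega

/-- The terms of the equation satisfied by the denominator `p` of a solution `1 / p`. -/
noncomputable def denTerm (p : ℝ[X]) : Vertex → ℝ[X]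
  | .three => E.A₃
  | .two => E.A₂ * p ^ (E.n₃ - E.n₂)
  | .one => E.A₁ * p ^ (E.n₃ - E.n₁)
  | .der => derivative p * p ^ (E.n₃ - 2)

/-- The polynomials `p` such that `1 / p` is a nonconstant solution. -/
structure IsDenominator (p : ℝ[X]) : Prop where
  natDegree_pos : 0 < p.natDegree
  sum_eq_zero : ∑ l, E.denTerm p l = 0

theorem sum_vertex {M : Type*} [AddCommMonoid M] (f : Vertex → M) :
    ∑ l, f l = f .three + (f .two + (f .one + f .der)) := by
  have : (Finset.univ : Finset Vertex) = {.three, .two, .one, .der} := rfl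
  rw [this, Finset.sum_insert (by decide), Finset.sum_insert (by decide),
    Finset.sum_insert (by decide), Finset.sum_singleton]

theorem inv_solves_iff {p : ℝ[X]} (hp : p ≠ 0) :
    (ratDeriv (algebraMap ℝ[X] (RatFunc ℝ) p)⁻¹ =
      algebraMap ℝ[X] (RatFunc ℝ) E.A₃ * (algebraMap ℝ[X] (RatFunc ℝ) p)⁻¹ ^ E.n₃ +
      algebraMap ℝ[X] (RatFunc ℝ) E.A₂ * (algebraMap ℝ[X] (RatFunc ℝ) p)⁻¹ ^ E.n₂ +
      algebraMap ℝ[X] (RatFunc ℝ) E.A₁ * (algebraMap ℝ[X] (RatFunc ℝ) p)⁻¹ ^ E.n₁) ↔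
    ∑ l, E.denTerm p l = 0 := by
  have h1 := E.one_lt_n₁
  have h2 := E.n₁_lt_n₂
  have h3 := E.n₂_lt_n₃
  have hd : ratDeriv (algebraMap ℝ[X] (RatFunc ℝ) p)⁻¹ =
      -algebraMap ℝ[X] (RatFunc ℝ) (derivative p) * (algebraMap ℝ[X] (RatFunc ℝ) p)⁻¹ ^ 2 := by
    have := ratDeriv_div 1 p hp
    rw [map_one, one_div] at this
    rw [this]
    simp [div_eq_mul_inv]
  have hinj := IsFractionRing.injective ℝ[X] (RatFunc ℝ)
  rw [hd, sum_vertex, ← hinj.eq_iff]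
  have ha : algebraMap ℝ[X] (RatFunc ℝ) p ≠ 0 := RatFunc.algebraMap_ne_zero hp
  simp only [denTerm, map_add, map_mul, map_pow, map_zero]
  generalize algebraMap ℝ[X] (RatFunc ℝ) p = a at *
  have e (k : ℕ) (hk : k ≤ E.n₃) : a⁻¹ ^ k = a ^ (E.n₃ - k) * a⁻¹ ^ E.n₃ := by
    conv_rhs => rw [← Nat.sub_add_cancel hk, Nat.add_sub_cancel, pow_add]
    rw [← mul_assoc, ← mul_pow, mul_inv_cancel₀ ha, one_pow, one_mul]
  rw [e E.n₂ (by omega), e E.n₁ (by omega), e 2 (by omega), ← sub_eq_zero]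
  have hb : a⁻¹ ^ E.n₃ ≠ 0 := pow_ne_zero _ (inv_ne_zero ha)
  generalize a⁻¹ ^ E.n₃ = b at *
  constructor
  · intro h
    apply mul_right_cancel₀ hb
    linear_combination -h
  · intro h
    linear_combination -b * h

/-- After clearing denominators, coprimality forces the numerator to divide its own derivative, so
the numerator is constant. -/
theorem exists_inv_of_mem_solutions {x : RatFunc ℝ} (hx : x ∈ E.solutions) :
    ∃ p : ℝ[X], x = (algebraMap ℝ[X] (RatFunc ℝ) p)⁻¹ := by
  obtain ⟨hc, hx⟩ := hx
  have h1 := E.one_lt_n₁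
  have h2 := E.n₁_lt_n₂
  have h3 := E.n₂_lt_n₃
  have hinj := IsFractionRing.injective ℝ[X] (RatFunc ℝ)
  have hv : x.denom ≠ 0 := RatFunc.denom_ne_zero x
  have hcop : IsCoprime x.num x.denom := RatFunc.isCoprime_num_denom x
  have hxe : x = algebraMap ℝ[X] (RatFunc ℝ) x.num / algebraMap ℝ[X] (RatFunc ℝ) x.denom :=
    (RatFunc.num_div_denom x).symm
  rw [ratDeriv] at hx
  have key : (derivative x.num * x.denom - x.num * derivative x.denom) * x.denom ^ (E.n₃ - 2) =
      E.A₃ * x.num ^ E.n₃ + E.A₂ * x.num ^ E.n₂ * x.denom ^ (E.n₃ - E.n₂) +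
      E.A₁ * x.num ^ E.n₁ * x.denom ^ (E.n₃ - E.n₁) := by
    rw [← hinj.eq_iff]
    generalize x.num = u at *
    generalize x.denom = v at *
    subst hxe
    have hv' : algebraMap ℝ[X] (RatFunc ℝ) v ≠ 0 := RatFunc.algebraMap_ne_zero hv
    rw [map_mul, (div_eq_iff (pow_ne_zero 2 hv')).mp hx]
    simp only [map_add, map_mul, map_pow]
    generalize algebraMap ℝ[X] (RatFunc ℝ) v = b at *
    generalize algebraMap ℝ[X] (RatFunc ℝ) u = a at *
    have e (k : ℕ) (hk : k ≤ E.n₃) : (a / b) ^ k * b ^ E.n₃ = a ^ k * b ^ (E.n₃ - k) := by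
      rw [div_pow, ← Nat.sub_add_cancel hk, Nat.add_sub_cancel, pow_add]
      field_simp
    have e2 : b ^ 2 * b ^ (E.n₃ - 2) = b ^ E.n₃ := by
      rw [← pow_add]
      congr 1
      omega
    have e3 := e E.n₃ le_rfl
    have e4 := e E.n₂ h3.le
    have e5 := e E.n₁ (by omega)
    rw [Nat.sub_self, pow_zero, mul_one] at e3
    rw [mul_assoc, e2, add_mul, add_mul, mul_assoc, mul_assoc, mul_assoc, e3, e4, e5]
    ring
  have hdvd : x.num ∣ derivative x.num := by
    have d1 : x.num ∣ (derivative x.num * x.denom - x.num * derivative x.denom) *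
        x.denom ^ (E.n₃ - 2) := by
      rw [key]
      exact dvd_add (dvd_add ((dvd_pow_self _ (by omega)).mul_left _)
        (((dvd_pow_self _ (by omega)).mul_left _).mul_right _))
        (((dvd_pow_self _ (by omega)).mul_left _).mul_right _)
    have d2 := (hcop.pow_right (n := E.n₃ - 2)).dvd_of_dvd_mul_right d1
    have d3 : x.num ∣ derivative x.num * x.denom := by
      have := dvd_add d2 (dvd_mul_right x.num (derivative x.denom))
      rwa [sub_add_cancel] at this
    exact hcop.dvd_of_dvd_mul_right d3
  have hder : derivative x.num = 0 := by
    by_contra h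
    have hlt := degree_derivative_lt (p := x.num) (by rintro h0; simp [h0] at h)
    exact absurd (degree_le_of_dvd hdvd h) (not_le.mpr hlt)
  have hu := eq_C_of_natDegree_eq_zero (derivative_eq_zero.mp hder)
  generalize x.num.coeff 0 = k at hu
  have hk : k ≠ 0 := by
    rintro rfl
    apply hc
    refine ⟨0, ?_⟩
    rw [hxe, hu]
    simp
  refine ⟨C k⁻¹ * x.denom, ?_⟩
  conv_lhs => rw [hxe, hu]
  rw [map_mul, mul_inv, RatFunc.algebraMap_C, RatFunc.algebraMap_C, map_inv₀, inv_inv,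
    div_eq_mul_inv]

theorem mem_solutions_iff (x : RatFunc ℝ) :
    x ∈ E.solutions ↔ ∃ p, E.IsDenominator p ∧ x = (algebraMap ℝ[X] (RatFunc ℝ) p)⁻¹ := by
  constructor
  · intro hx
    obtain ⟨p, rfl⟩ := E.exists_inv_of_mem_solutions hx
    have hpos : 0 < p.natDegree := by
      by_contra h
      apply hx.1
      refine ⟨(p.coeff 0)⁻¹, ?_⟩
      rw [eq_C_of_natDegree_eq_zero (by omega : p.natDegree = 0)]
      simp
    refine ⟨p, ⟨hpos, ?_⟩, rfl⟩
    exact (E.inv_solves_iff (by rintro rfl; simp at hpos)).mp hx.2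
  · rintro ⟨p, hp, rfl⟩
    have hp0 : p ≠ 0 := by
      rintro rfl
      simpa using hp.natDegree_pos
    refine ⟨?_, (E.inv_solves_iff hp0).mpr hp.sum_eq_zero⟩
    rintro ⟨c, hc⟩
    have h1 : algebraMap ℝ[X] (RatFunc ℝ) p = algebraMap ℝ[X] (RatFunc ℝ) (C c⁻¹) := by
      rw [RatFunc.algebraMap_C, map_inv₀, ← hc, inv_inv]
    have h2 := IsFractionRing.injective ℝ[X] (RatFunc ℝ) h1
    have := hp.natDegree_pos
    rw [h2, natDegree_C] at this
    exact lt_irrefl _ this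

theorem IsDenominator.ne_zero {E : AbelEquation} {p : ℝ[X]} (hp : E.IsDenominator p) : p ≠ 0 := by
  rintro rfl
  simpa using hp.natDegree_pos

/-- Only `deg p ≤ r` is required, so that a solution of smaller degree can be compared at the same
exponents, with `p.coeff r = 0`. -/
theorem natDegree_coeff_denTerm {r : ℕ} (hr : 0 < r) {p : ℝ[X]} (hp : p.natDegree ≤ r)
    (l : Vertex) :
    (E.denTerm p l).natDegree ≤ E.topExp r l ∧
      (E.denTerm p l).coeff (E.topExp r l) =
        E.edgeCoeff r l * p.coeff r ^ (E.n₃ - E.n l) := by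
  have h1 := E.one_lt_n₁
  have h2 := E.n₁_lt_n₂
  have h3 := E.n₂_lt_n₃
  cases l <;> simp only [denTerm, topExp, edgeCoeff, n]
  · simp
  · refine ⟨natDegree_mul_le_of_le le_rfl (natDegree_pow_le_of_le _ hp), ?_⟩
    rw [coeff_mul_add_eq_of_natDegree_le le_rfl (natDegree_pow_le_of_le _ hp),
      coeff_pow_of_natDegree_le hp, coeff_natDegree]
  · refine ⟨natDegree_mul_le_of_le le_rfl (natDegree_pow_le_of_le _ hp), ?_⟩
    rw [coeff_mul_add_eq_of_natDegree_le le_rfl (natDegree_pow_le_of_le _ hp),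
      coeff_pow_of_natDegree_le hp, coeff_natDegree]
  · have hd : (derivative p).natDegree ≤ r - 1 := (natDegree_derivative_le p).trans (by omega)
    refine ⟨natDegree_mul_le_of_le hd (natDegree_pow_le_of_le _ hp), ?_⟩
    rw [coeff_mul_add_eq_of_natDegree_le hd (natDegree_pow_le_of_le _ hp),
      coeff_pow_of_natDegree_le hp, coeff_derivative]
    obtain ⟨s, rfl⟩ : ∃ s, r = s + 1 := ⟨r - 1, by omega⟩
    obtain ⟨m, hm⟩ : ∃ m, E.n₃ = m + 2 := ⟨E.n₃ - 2, by omega⟩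
    rw [hm]
    simp only [Nat.add_sub_cancel, show m + 2 - 1 = m + 1 by omega]
    push_cast
    ring

theorem coeff_denTerm {r : ℕ} (hr : 0 < r) {p : ℝ[X]} (hp : p.natDegree ≤ r)
    (l : Vertex) {N : ℕ} (hN : E.topExp r l ≤ N) :
    (E.denTerm p l).coeff N =
      if E.topExp r l = N then E.edgeCoeff r l * p.coeff r ^ (E.n₃ - E.n l) else 0 := by
  obtain ⟨h1, h2⟩ := E.natDegree_coeff_denTerm hr hp l
  split_ifs with h
  · rw [← h, h2]
  · exact coeff_eq_zero_of_natDegree_lt (by omega)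

theorem eval_edgeTerm (r : ℕ) (l : Vertex) {c : ℝ} (hc : c ≠ 0) :
    (E.edgeTerm r l).eval c⁻¹ * c ^ E.n₃ = E.edgeCoeff r l * c ^ (E.n₃ - E.n l) := by
  rw [edgeTerm_eq]
  have e : c ^ E.n₃ = c ^ E.n l * c ^ (E.n₃ - E.n l) := by
    rw [← pow_add, Nat.add_sub_cancel' (E.n_le l)]
  simp only [eval_mul, eval_C, eval_pow, eval_X]
  rw [e, inv_pow]
  field_simp

theorem eval_derivative_edgeTerm (r : ℕ) (l : Vertex) (c : ℝ) :
    (derivative (E.edgeTerm r l)).eval c * c = E.n l * (E.edgeTerm r l).eval c := by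
  rw [edgeTerm_eq]
  have h := E.n_pos l
  obtain ⟨m, hm⟩ : ∃ m, E.n l = m + 1 := ⟨E.n l - 1, by omega⟩
  rw [hm]
  simp
  ring

theorem eval_P_mul (r : ℕ) {c : ℝ} (hc : c ≠ 0) :
    (E.P r).eval c⁻¹ * c ^ E.n₃ = ∑ l ∈ E.T r, E.edgeCoeff r l * c ^ (E.n₃ - E.n l) := by
  rw [P, eval_finsetSum, Finset.sum_mul]
  exact Finset.sum_congr rfl fun l _ => E.eval_edgeTerm r l hc

theorem eval_derivative_P_mul (r : ℕ) {c : ℝ} (hc : c ≠ 0) :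
    (derivative (E.P r)).eval c⁻¹ * c⁻¹ * c ^ E.n₃ =
      ∑ l ∈ E.T r, E.n l * (E.edgeCoeff r l * c ^ (E.n₃ - E.n l)) := by
  rw [P, derivative_sum, eval_finsetSum, Finset.sum_mul, Finset.sum_mul]
  refine Finset.sum_congr rfl fun l _ => ?_
  rw [eval_derivative_edgeTerm, mul_assoc, E.eval_edgeTerm r l hc]

theorem IsDenominator.eval_P {E : AbelEquation} {p : ℝ[X]} (hp : E.IsDenominator p) :
    (E.P p.natDegree).eval p.leadingCoeff⁻¹ = 0 := by
  have hc : p.leadingCoeff ≠ 0 := leadingCoeff_ne_zero.mpr hp.ne_zero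
  obtain ⟨M, hM, hT⟩ := E.exists_topExp_max hp.natDegree_pos
  have h := congrArg (fun f : ℝ[X] => f.coeff M) hp.sum_eq_zero
  simp only [finsetSum_coeff, coeff_zero] at h
  have h' := E.eval_P_mul p.natDegree hc
  rw [Finset.sum_congr rfl fun l _ => E.coeff_denTerm hp.natDegree_pos le_rfl l (hM l)] at h
  rw [← Finset.sum_filter, coeff_natDegree] at h
  have hfil : Finset.univ.filter (fun l => E.topExp p.natDegree l = M) = E.T p.natDegree := by
    ext l
    simp [hT]
  rw [hfil, ← h'] at h
  exact (mul_eq_zero.mp h).resolve_right (pow_ne_zero _ hc)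

theorem T_nonempty (r : ℕ) : (E.T r).Nonempty := by
  obtain ⟨k, -, hk⟩ := Finset.exists_min_image Finset.univ (fun l => E.Phi l r)
    ⟨Vertex.three, by simp⟩
  exact ⟨k, (E.mem_T_iff r k).mpr fun l => hk l (by simp)⟩

/-- The four exponents are distinct, so tied terms cannot cancel. -/
theorem P_ne_zero {r : ℕ} (hr : 0 < r) : E.P r ≠ 0 := by
  obtain ⟨l, hl⟩ := E.T_nonempty r
  intro h
  have h1 := congrArg (fun f : ℝ[X] => f.coeff (E.n l)) h
  simp only [P, edgeTerm_eq, finsetSum_coeff, coeff_C_mul, coeff_X_pow, coeff_zero,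
    E.n_injective.eq_iff] at h1
  simp [hl, E.edgeCoeff_ne_zero hr] at h1

/-- With a single minimizer `P_r` would be a monomial, which has no nonzero root. -/
theorem IsDenominator.edgeAdmissible {E : AbelEquation} {p : ℝ[X]} (hp : E.IsDenominator p) :
    E.EdgeAdmissible p.natDegree := by
  refine ⟨hp.natDegree_pos, ?_⟩
  by_contra h
  have hne := (E.T_nonempty p.natDegree).card_pos
  obtain ⟨l, hl⟩ := Finset.card_eq_one.mp (by omega : (E.T p.natDegree).card = 1)
  have h1 := hp.eval_P
  have hc : p.leadingCoeff ≠ 0 := leadingCoeff_ne_zero.mpr hp.ne_zero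
  rw [P, hl, Finset.sum_singleton, edgeTerm_eq] at h1
  simp [E.edgeCoeff_ne_zero hp.natDegree_pos, hp.ne_zero] at h1

/-- Every other term of the identity is divisible by `p^(n₃-n₂)`, hence so is `A₃`. -/
theorem IsDenominator.mul_natDegree_le {E : AbelEquation} {p : ℝ[X]} (hp : E.IsDenominator p) :
    (E.n₃ - E.n₂) * p.natDegree ≤ E.A₃.natDegree := by
  have h1 := E.one_lt_n₁
  have h2 := E.n₁_lt_n₂
  have h3 := E.n₂_lt_n₃
  have h := hp.sum_eq_zero
  rw [sum_vertex] at h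
  simp only [denTerm] at h
  rw [← natDegree_pow]
  refine natDegree_le_of_dvd ?_ E.A₃_ne_zero
  rw [eq_neg_of_add_eq_zero_left h, dvd_neg]
  exact dvd_add (dvd_mul_left _ _) (dvd_add ((pow_dvd_pow _ (by omega)).mul_left _)
    ((pow_dvd_pow _ (by omega)).mul_left _))

theorem IsDenominator.mem_Gam {E : AbelEquation} {p : ℝ[X]} (hp : E.IsDenominator p) :
    p.natDegree ∈ E.Gam := by
  refine ⟨hp.natDegree_pos, ?_, ?_⟩
  · have h3 := E.n₂_lt_n₃
    have h : (0 : ℚ) < (E.n₃ : ℚ) - E.n₂ := by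
      rw [sub_pos]
      exact_mod_cast h3
    rw [le_div_iff₀ h, ← Nat.cast_sub h3.le, mul_comm]
    exact_mod_cast hp.mul_natDegree_le
  · obtain ⟨i, hi, j, hj, hij⟩ := Finset.one_lt_card.mp hp.edgeAdmissible.2
    refine ⟨i, j, hij, ?_⟩
    rw [mem_T_iff] at hi hj
    have he := le_antisymm (hi j) (hj i)
    have hn : (E.n i : ℚ) - E.n j ≠ 0 := by
      rw [sub_ne_zero]
      exact_mod_cast fun h => hij (E.n_injective h)
    rw [tieValue, eq_div_iff hn]
    simp only [Phi] at he
    have he' : (E.n i : ℚ) * p.natDegree - E.a i = E.n j * p.natDegree - E.a j := by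
      exact_mod_cast he
    linear_combination he'

end AbelEquation

/-! ### Nondegeneracy: uniqueness for a given leading coefficient, and the alternatives -/

namespace AbelEquation

variable (E : AbelEquation)

theorem X_pow_mul_Ptilde (r : ℕ) : X ^ (E.P r).rootMultiplicity 0 * E.Ptilde r = E.P r := by
  have h := pow_mul_divByMonic_rootMultiplicity_eq (E.P r) 0
  rwa [map_zero, sub_zero] at h

theorem Ptilde_ne_zero {r : ℕ} (hr : 0 < r) : E.Ptilde r ≠ 0 := by
  intro h
  have := E.X_pow_mul_Ptilde r
  rw [h, mul_zero] at this
  exact E.P_ne_zero hr this.symm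

theorem eval_Ptilde_eq_zero {r : ℕ} {x : ℝ} (hx : x ≠ 0) (h : (E.P r).eval x = 0) :
    (E.Ptilde r).eval x = 0 := by
  rw [← E.X_pow_mul_Ptilde r, eval_mul, eval_pow, eval_X] at h
  exact (mul_eq_zero.mp h).resolve_left (pow_ne_zero _ hx)

theorem ND1.eval_derivative_ne_zero {E : AbelEquation} {r : ℕ} (hr : 0 < r) (h : E.ND1 r) {x : ℝ}
    (hx : x ≠ 0) (hP : (E.P r).eval x = 0) : (derivative (E.P r)).eval x ≠ 0 := by
  intro hP'
  have h0 := E.eval_Ptilde_eq_zero hx hP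
  apply h
  apply resultant_eq_zero_of_common_root (E.Ptilde_ne_zero hr) h0
  rw [← E.X_pow_mul_Ptilde r, derivative_mul, eval_add, eval_mul, eval_mul, h0, mul_zero,
    zero_add, eval_pow, eval_X] at hP'
  exact (mul_eq_zero.mp hP').resolve_left (pow_ne_zero _ hx)

theorem ND3.eval_neg_ne_zero {E : AbelEquation} {r : ℕ} (hr : 0 < r) (h : E.ND3 r)
    (heven : Even (E.n₃ - E.n₂) ∨ Even (E.n₃ - E.n₁) ∨ Even (E.n₃ - 1)) {x : ℝ}
    (hx : x ≠ 0) (hP : (E.P r).eval x = 0) : (E.P r).eval (-x) ≠ 0 := by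
  intro hP'
  apply h heven
  apply resultant_eq_zero_of_common_root (E.Ptilde_ne_zero hr) (E.eval_Ptilde_eq_zero hx hP)
  simpa using E.eval_Ptilde_eq_zero (neg_ne_zero.mpr hx) hP'

/-- The linearization of each term in the direction `p - q`. The extra factor `p.coeff r` restores
the power lost by differentiating, so the result is expressed in the terms of `P_r` and `P_r'`. -/
theorem coeff_denTerm_sub {r j : ℕ} (hr : 0 < r) {p q : ℝ[X]} (hp : p.natDegree ≤ r)
    (hq : q.natDegree ≤ r) (hpq : p.coeff r = q.coeff r) (hs : (p - q).natDegree ≤ j)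
    (l : Vertex) {N : ℕ} (hN : E.topExp r l + j ≤ N + r) :
    (E.denTerm p l - E.denTerm q l).coeff N * p.coeff r =
      if E.topExp r l + j = N + r then
        (p - q).coeff j * (((E.n₃ : ℝ) - E.n l) * (E.edgeCoeff r l * p.coeff r ^ (E.n₃ - E.n l))
          - if l = .der then ((r : ℝ) - j) * p.coeff r ^ (E.n₃ - 1) else 0)
      else 0 := by
  have h1 := E.one_lt_n₁
  have h2 := E.n₁_lt_n₂
  have h3 := E.n₂_lt_n₃
  have main (A : ℝ[X]) (m : ℕ) (hA : A.natDegree + (m + 1) * r + j ≤ N + r) :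
      (A * p ^ (m + 1) - A * q ^ (m + 1)).coeff N * p.coeff r =
      if A.natDegree + (m + 1) * r + j = N + r then
        (p - q).coeff j * (((m : ℝ) + 1) * (A.leadingCoeff * p.coeff r ^ (m + 1))) else 0 := by
    obtain ⟨d1, d2⟩ := pow_sub_pow_natDegree_coeff hp hq hpq hs m
    have e : (m + 1) * r = m * r + r := by ring
    rw [← mul_sub]
    split_ifs with h
    · obtain rfl : N = A.natDegree + (m * r + j) := by omega
      rw [coeff_mul_add_eq_of_natDegree_le le_rfl d1, d2, coeff_natDegree]
      ring
    · rw [coeff_eq_zero_of_natDegree_lt, zero_mul]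
      exact (natDegree_mul_le_of_le le_rfl d1).trans_lt (by omega)
  cases l <;> simp only [denTerm, topExp, edgeCoeff, n] at hN ⊢
  · simp
  · obtain ⟨m, hm⟩ : ∃ m, E.n₃ = E.n₂ + (m + 1) := ⟨E.n₃ - E.n₂ - 1, by omega⟩
    have e : E.n₃ - E.n₂ = m + 1 := by omega
    have e' : (E.n₃ : ℝ) - E.n₂ = m + 1 := by rw [hm]; push_cast; ring
    rw [e] at hN
    simpa [e, e'] using main E.A₂ m hN
  · obtain ⟨m, hm⟩ : ∃ m, E.n₃ = E.n₁ + (m + 1) := ⟨E.n₃ - E.n₁ - 1, by omega⟩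
    have e : E.n₃ - E.n₁ = m + 1 := by omega
    have e' : (E.n₃ : ℝ) - E.n₁ = m + 1 := by rw [hm]; push_cast; ring
    rw [e] at hN
    simpa [e, e'] using main E.A₁ m hN
  · obtain ⟨m, hm⟩ : ∃ m, E.n₃ = m + 2 := ⟨E.n₃ - 2, by omega⟩
    -- Up to the factor `m + 1`, the `∂` term is an exact derivative, which reduces it to a
    -- difference of powers.
    have hder : derivative (p ^ (m + 1) - q ^ (m + 1)) =
        C ((m : ℝ) + 1) * (derivative p * p ^ m - derivative q * q ^ m) := by
      simp only [derivative_sub, derivative_pow, Nat.add_sub_cancel]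
      push_cast
      ring
    have hm1 : (m : ℝ) + 1 ≠ 0 := by positivity
    obtain ⟨d1, d2⟩ := pow_sub_pow_natDegree_coeff hp hq hpq hs m
    have hc := congrArg (fun f : ℝ[X] => f.coeff N) hder
    simp only [coeff_derivative, coeff_C_mul] at hc
    simp only [hm, Nat.add_sub_cancel, show m + 2 - 1 = m + 1 by omega] at hN ⊢
    split_ifs with h
    · have hNr : N + 1 = m * r + j := by omega
      have hNr' : (N : ℝ) + 1 = m * r + j := by exact_mod_cast hNr
      rw [hNr, d2, hNr'] at hc
      apply mul_left_cancel₀ hm1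
      rw [← mul_assoc, ← hc]
      push_cast
      ring
    · rw [coeff_eq_zero_of_natDegree_lt (by omega : _ < N + 1), zero_mul] at hc
      rw [(mul_eq_zero.mp hc.symm).resolve_left hm1, zero_mul]

/-- If `p - q` had degree `j < r`, the top coefficient of the difference of the two identities would
give, at the root `c⁻¹` of `P_r`, either `P_r'(c⁻¹) = j - r` when `∂ ∈ T_r`, against (ND2), or
`P_r'(c⁻¹) = 0` otherwise, against (ND1). -/
theorem IsDenominator.eq_of_leadingCoeff_eq {E : AbelEquation} (hND : E.ND) {p q : ℝ[X]}
    (hp : E.IsDenominator p) (hq : E.IsDenominator q) (hdeg : p.natDegree = q.natDegree)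
    (hlc : p.leadingCoeff = q.leadingCoeff) : p = q := by
  by_contra hne
  obtain ⟨nd1, nd2, -⟩ := hND _ hp.mem_Gam hp.edgeAdmissible
  have hr := hp.natDegree_pos
  have hP := hp.eval_P
  have hpq : p.coeff p.natDegree = q.coeff p.natDegree := by
    rw [coeff_natDegree, hlc, hdeg, coeff_natDegree]
  set r := p.natDegree with hrdef
  set j := (p - q).natDegree with hjdef
  have hs : p - q ≠ 0 := sub_ne_zero.mpr hne
  have hj : j < r := by
    have hle : j ≤ r := (natDegree_sub_le _ _).trans (by omega)
    refine lt_of_le_of_ne hle fun h => ?_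
    have h1 : (p - q).coeff j = 0 := by rw [h, coeff_sub, hpq, sub_self]
    exact hs (leadingCoeff_eq_zero.mp h1)
  have hσ : (p - q).coeff j ≠ 0 := leadingCoeff_ne_zero.mpr hs
  have hc : p.coeff r ≠ 0 := leadingCoeff_ne_zero.mpr hp.ne_zero
  change (E.P r).eval (p.coeff r)⁻¹ = 0 at hP
  obtain ⟨M, hM, hT⟩ := E.exists_topExp_max hr
  -- The `∂` term already has top exponent at least `r`, so the index `N = M + j - r` is a genuine
  -- natural number.
  have hMr : r ≤ M + j := by
    have h1 := E.one_lt_n₁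
    have h2 := E.n₁_lt_n₂
    have h3 := E.n₂_lt_n₃
    have h4 := hM .der
    simp only [topExp] at h4
    have h5 : 1 * r ≤ (E.n₃ - 2) * r := Nat.mul_le_mul_right r (by omega)
    omega
  obtain ⟨N, hN⟩ : ∃ N, M + j = N + r := ⟨M + j - r, by omega⟩
  have hsum : ∑ l, (E.denTerm p l - E.denTerm q l).coeff N * p.coeff r = 0 := by
    rw [← Finset.sum_mul, ← finsetSum_coeff, Finset.sum_sub_distrib, hp.sum_eq_zero,
      hq.sum_eq_zero]
    simp
  have hfil : Finset.univ.filter (fun l => E.topExp r l + j = N + r) = E.T r := by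
    ext l
    simp only [Finset.mem_filter, Finset.mem_univ, true_and, hT]
    omega
  rw [Finset.sum_congr rfl fun l _ => E.coeff_denTerm_sub hr le_rfl hdeg.ge hpq le_rfl l
    (by have := hM l; omega), ← Finset.sum_filter, hfil, ← Finset.mul_sum] at hsum
  have hsum' := (mul_eq_zero.mp hsum).resolve_left hσ
  have e1 := E.eval_P_mul r hc
  have e2 := E.eval_derivative_P_mul r hc
  rw [hP, zero_mul] at e1
  simp only [sub_mul] at hsum'
  rw [Finset.sum_sub_distrib, Finset.sum_sub_distrib, ← Finset.mul_sum, ← e1, ← e2, mul_zero,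
    Finset.sum_ite_eq'] at hsum'
  have e3 : (p.coeff r)⁻¹ * p.coeff r ^ E.n₃ = p.coeff r ^ (E.n₃ - 1) := by
    obtain ⟨m, hm⟩ : ∃ m, E.n₃ = m + 1 := ⟨E.n₃ - 1, by have := E.n₂_lt_n₃; omega⟩
    rw [hm, pow_succ, Nat.add_sub_cancel]
    field_simp
  rw [mul_assoc, e3] at hsum'
  have hpow : p.coeff r ^ (E.n₃ - 1) ≠ 0 := pow_ne_zero _ hc
  by_cases hder : Vertex.der ∈ E.T r
  · rw [if_pos hder] at hsum'
    refine nd2 hder _ (inv_ne_zero hc) hP ((j : ℤ) - r) (by omega) ?_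
    apply mul_right_cancel₀ hpow
    push_cast
    linear_combination -hsum'
  · rw [if_neg hder] at hsum'
    refine nd1.eval_derivative_ne_zero hr (inv_ne_zero hc) hP ?_
    exact (mul_eq_zero.mp (by linear_combination -hsum')).resolve_right hpow

/-- In equal degree the leading coefficients differ by uniqueness, so equal powers would make them
opposite with an even exponent; then `P_r` would have two opposite roots, which (ND3) forbids. In
smaller degree the right side vanishes. -/
theorem IsDenominator.pow_coeff_ne {E : AbelEquation} (hND : E.ND) {p q : ℝ[X]}
    (hp : E.IsDenominator p) (hq : E.IsDenominator q) (hne : p ≠ q)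
    (hdeg : q.natDegree ≤ p.natDegree) {l : Vertex} (hl : l ≠ .three) :
    p.coeff p.natDegree ^ (E.n₃ - E.n l) ≠ q.coeff p.natDegree ^ (E.n₃ - E.n l) := by
  obtain ⟨-, -, nd3⟩ := hND _ hp.mem_Gam hp.edgeAdmissible
  have hm : E.n₃ - E.n l ≠ 0 := by
    have h1 := E.n_le l
    have h2 := E.n_injective.ne hl
    simp only [n] at h1 h2 ⊢
    omega
  have hc : p.coeff p.natDegree ≠ 0 := leadingCoeff_ne_zero.mpr hp.ne_zero
  rcases hdeg.lt_or_eq with hlt | heq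
  · rw [coeff_eq_zero_of_natDegree_lt hlt, zero_pow hm]
    exact pow_ne_zero _ hc
  · have hlc : p.leadingCoeff ≠ q.leadingCoeff := fun h =>
      hne (hp.eq_of_leadingCoeff_eq hND hq heq.symm h)
    rw [← heq, coeff_natDegree, heq, coeff_natDegree]
    intro h
    rcases (pow_eq_pow_iff_cases).mp h with h0 | h0 | ⟨h0, hev⟩
    · exact hm h0
    · exact hlc h0
    · have hP := hq.eval_P
      have hx : p.leadingCoeff⁻¹ ≠ 0 := inv_ne_zero (leadingCoeff_ne_zero.mpr hp.ne_zero)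
      refine nd3.eval_neg_ne_zero hp.natDegree_pos ?_ hx hp.eval_P ?_
      · cases l
        · exact absurd rfl hl
        · exact Or.inl hev
        · exact Or.inr (Or.inl hev)
        · exact Or.inr (Or.inr hev)
      · rw [← heq, h0, ← inv_neg, neg_neg]
        exact hP

theorem IsDenominator.alternatives {E : AbelEquation} (hND : E.ND) {p q : ℝ[X]}
    (hp : E.IsDenominator p) (hq : E.IsDenominator q) (hne : p ≠ q)
    (hdeg : q.natDegree ≤ p.natDegree) :
    E.C1 p.natDegree ∨ E.C2 p.natDegree ∨ E.C3 p.natDegree := by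
  have hr := hp.natDegree_pos
  have hsum (N : ℕ) : ∑ l, ((E.denTerm p l).coeff N - (E.denTerm q l).coeff N) = 0 := by
    rw [Finset.sum_sub_distrib, ← finsetSum_coeff, ← finsetSum_coeff, hp.sum_eq_zero,
      hq.sum_eq_zero, sub_self]
  -- A label strictly above the other two would leave an uncancelled top coefficient in the
  -- difference of the identities, so the maximum over `2, 1, ∂` is attained twice.
  have key (l : Vertex) (hl : l ≠ .three) :
      ∃ k, k ≠ .three ∧ k ≠ l ∧ E.topExp p.natDegree l ≤ E.topExp p.natDegree k := by
    by_contra! hcon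
    have h := hsum (E.topExp p.natDegree l)
    rw [Finset.sum_eq_single l] at h
    · rw [E.coeff_denTerm hr le_rfl l le_rfl, E.coeff_denTerm hr hdeg l le_rfl, if_pos rfl,
        if_pos rfl, ← mul_sub] at h
      exact hp.pow_coeff_ne hND hq hne hdeg hl
        (sub_eq_zero.mp ((mul_eq_zero.mp h).resolve_left (E.edgeCoeff_ne_zero hr l)))
    · intro k _ hk
      by_cases hk3 : k = .three
      · subst hk3
        simp [denTerm]
      · have hlt := hcon k hk3 hk
        rw [E.coeff_denTerm hr le_rfl k hlt.le, E.coeff_denTerm hr hdeg k hlt.le,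
          if_neg hlt.ne, if_neg hlt.ne, sub_self]
    · simp
  have t2 := E.topExp_cast hr .two
  have t1 := E.topExp_cast hr .one
  have td := E.topExp_cast hr .der
  have k2 : E.topExp p.natDegree .two ≤ E.topExp p.natDegree .one ∨
      E.topExp p.natDegree .two ≤ E.topExp p.natDegree .der := by
    obtain ⟨k, hk3, hk, h⟩ := key .two (by decide)
    cases k <;> simp_all
  have k1 : E.topExp p.natDegree .one ≤ E.topExp p.natDegree .two ∨
      E.topExp p.natDegree .one ≤ E.topExp p.natDegree .der := by
    obtain ⟨k, hk3, hk, h⟩ := key .one (by decide)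
    cases k <;> simp_all
  have kd : E.topExp p.natDegree .der ≤ E.topExp p.natDegree .two ∨
      E.topExp p.natDegree .der ≤ E.topExp p.natDegree .one := by
    obtain ⟨k, hk3, hk, h⟩ := key .der (by decide)
    cases k <;> simp_all
  simp only [Phi, n, a] at t2 t1 td
  simp only [C1, C2, C3, sub_mul]
  push_cast at t2 t1 td ⊢
  omega

/-- If `∂` ties with exactly one other label then `P_r'` takes a negative integer value at every
nonzero root of `P_r`. -/
theorem T_ne_pair_der {r : ℕ} (nd2 : E.ND2 r) {x : ℝ} (hx : x ≠ 0)
    (hP : (E.P r).eval x = 0) (hr : 0 < r) {l : Vertex} (hl : l ≠ .der) :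
    E.T r ≠ {l, Vertex.der} := by
  intro hT
  have hmem : Vertex.der ∈ E.T r := by simp [hT]
  have hn : 1 < E.n l := by
    have h1 := E.n_pos l
    have h2 := E.n_injective.ne hl
    simp only [n] at h1 h2 ⊢
    omega
  -- At a root the term of `l` equals `-r x`, so Euler's relation gives `x P_r'(x) = -n_l r x + r
  -- x`.
  refine nd2 hmem x hx hP (-(((E.n l : ℤ) - 1) * r)) ?_ ?_
  · have : (0 : ℤ) < ((E.n l : ℤ) - 1) * r := by
      apply mul_pos <;> omega
    omega
  · have h1 : (E.edgeTerm r l).eval x + r * x = 0 := by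
      rw [P, hT, Finset.sum_pair hl] at hP
      simpa [edgeTerm] using hP
    have h2 := E.eval_derivative_edgeTerm r l x
    apply mul_right_cancel₀ hx
    rw [P, hT, Finset.sum_pair hl, derivative_add, eval_add, add_mul, h2]
    have hd : E.edgeTerm r .der = C (r : ℝ) * X := rfl
    rw [hd, derivative_C_mul_X, eval_C]
    push_cast
    linear_combination (E.n l : ℝ) * h1

/-- The denominators of degree `r` of nonconstant solutions. -/
def denominators (r : ℕ) : Set ℝ[X] :=
  {p | E.IsDenominator p ∧ p.natDegree = r}

theorem encard_denominators_le (hND : E.ND) (r : ℕ) :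
    (E.denominators r).encard ≤ {x : ℝ | x ≠ 0 ∧ (E.P r).eval x = 0}.encard := by
  refine Set.encard_le_encard_of_injOn (f := fun p => p.leadingCoeff⁻¹) ?_ ?_
  · rintro p ⟨hp, rfl⟩
    exact ⟨inv_ne_zero (leadingCoeff_ne_zero.mpr hp.ne_zero), hp.eval_P⟩
  · rintro p ⟨hp, hpr⟩ q ⟨hq, hqr⟩ h
    exact hp.eq_of_leadingCoeff_eq hND hq (hpr.trans hqr.symm) (inv_injective h)

end AbelEquation

/-! ### Tie sets at smaller degrees and the count of solutions -/

namespace AbelEquation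

variable (E : AbelEquation)

/-- `Φ_l - Φ_k` is affine in the degree with positive slope `n_l - n_k`. -/
theorem Phi_lt_Phi_of_lt {d r : ℕ} (hdr : d < r) {k l : Vertex} (hkl : E.n k < E.n l)
    (h : E.Phi l r ≤ E.Phi k r) : E.Phi l d < E.Phi k d := by
  have h1 : (E.n k : ℤ) * (r - d) < E.n l * (r - d) :=
    mul_lt_mul_of_pos_right (by exact_mod_cast hkl) (by omega)
  simp only [Phi] at h ⊢
  linarith

theorem T_eq_of_three_mem {d r : ℕ} (hdr : d < r) (h : Vertex.three ∈ E.T r) :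
    E.T d = {Vertex.three} := by
  rw [mem_T_iff] at h
  have key (k : Vertex) (hk : k ≠ .three) : E.Phi .three d < E.Phi k d :=
    E.Phi_lt_Phi_of_lt hdr (lt_of_le_of_ne (E.n_le k) (E.n_injective.ne hk)) (h k)
  ext l
  rw [mem_T_iff, Finset.mem_singleton]
  constructor
  · intro hl
    by_contra hne
    exact absurd (hl .three) (not_le.mpr (key l hne))
  · rintro rfl k
    by_cases hk : k = .three
    · rw [hk]
    · exact (key k hk).le

theorem T_subset_of_two_mem {d r : ℕ} (hdr : d < r) (h : Vertex.two ∈ E.T r) :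
    E.T d ⊆ {Vertex.three, Vertex.two} := by
  rw [mem_T_iff] at h
  have h1 := E.one_lt_n₁
  have h2 := E.n₁_lt_n₂
  have k1 : E.Phi .two d < E.Phi .one d := E.Phi_lt_Phi_of_lt hdr h2 (h .one)
  have kd : E.Phi .two d < E.Phi .der d :=
    E.Phi_lt_Phi_of_lt hdr (show 1 < E.n₂ by omega) (h .der)
  intro l hl
  rw [mem_T_iff] at hl
  have := hl .two
  cases l
  · simp
  · simp
  · omega
  · omega

theorem T_eq_of_two_mem {d r : ℕ} (hdr : d < r) (h : Vertex.two ∈ E.T r)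
    (hd : E.EdgeAdmissible d) : E.T d = {Vertex.three, Vertex.two} :=
  Finset.eq_of_subset_of_card_le (E.T_subset_of_two_mem hdr h) hd.2

/-- The label `3` in the tie set of the larger degree would reduce that of the smaller one to `{3}`.
-/
theorem eq_of_T_eq {d e : ℕ} (hd : E.T d = {Vertex.three, Vertex.two})
    (he : E.T e = {Vertex.three, Vertex.two}) : d = e := by
  have key {a b : ℕ} (ha : E.T a = {Vertex.three, Vertex.two})
      (hb : E.T b = {Vertex.three, Vertex.two}) : ¬ a < b := by
    intro hab
    have h := E.T_eq_of_three_mem hab (by simp [hb])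
    rw [ha] at h
    exact absurd (congrArg Finset.card h) (by decide)
  exact le_antisymm (not_lt.mp (key he hd)) (not_lt.mp (key hd he))

theorem encard_roots_le_two {r : ℕ} (hr : 0 < r) {k l : Vertex}
    (hT : E.T r = {k, l}) (hkl : E.n l < E.n k) : {x : ℝ | x ≠ 0 ∧ (E.P r).eval x = 0}.encard ≤ 2 := by
  have h1 : k ≠ l := by rintro rfl; omega
  rw [P, hT, Finset.sum_pair h1, edgeTerm_eq, edgeTerm_eq]
  exact encard_nonzero_roots_binomial_le (E.edgeCoeff_ne_zero hr _) (E.edgeCoeff_ne_zero hr _) hkl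

theorem encard_roots_le_four {r : ℕ} (hr : 0 < r) {k l m : Vertex}
    (hT : E.T r = {k, l, m}) (hkl : E.n l < E.n k) (hlm : E.n m < E.n l) :
    {x : ℝ | x ≠ 0 ∧ (E.P r).eval x = 0}.encard ≤ 4 := by
  have h1 : k ≠ l := by rintro rfl; omega
  have h2 : l ≠ m := by rintro rfl; omega
  have h3 : k ≠ m := by rintro rfl; omega
  rw [P, hT, Finset.sum_insert (by simp [h1, h3]), Finset.sum_pair h2, edgeTerm_eq, edgeTerm_eq,
    edgeTerm_eq]
  exact encard_nonzero_roots_trinomial_le (E.edgeCoeff_ne_zero hr _) (E.edgeCoeff_ne_zero hr _)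
    (E.edgeCoeff_ne_zero hr _) hkl hlm

/-- Were all gaps even, every exponent would be odd since `n_∂ = 1`; then `P_r` would be odd and
`-x` a root too, against (ND3). So some gap is odd and Descartes' bound drops from 6 to 5. -/
theorem encard_roots_le_five {r : ℕ} (hr : 0 < r) (nd3 : E.ND3 r)
    (hT : E.T r = {.three, .two, .one, .der}) {x : ℝ} (hx : x ≠ 0) (hP : (E.P r).eval x = 0) :
    {x : ℝ | x ≠ 0 ∧ (E.P r).eval x = 0}.encard ≤ 5 := by
  have h1 := E.one_lt_n₁
  have h2 := E.n₁_lt_n₂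
  have h3 := E.n₂_lt_n₃
  have hodd : Odd (E.n₃ + E.n₂) ∨ Odd (E.n₂ + E.n₁) ∨ Odd (E.n₁ + 1) := by
    by_contra! hcon
    obtain ⟨e1, e2, e3⟩ := hcon
    have o1 : Odd E.n₁ := by grind
    have o2 : Odd E.n₂ := by grind
    have o3 : Odd E.n₃ := by grind
    have hall (l : Vertex) : Odd (E.n l) := by
      cases l
      exacts [o3, o2, o1, odd_one]
    refine nd3.eval_neg_ne_zero hr (Or.inr (Or.inr (Nat.Odd.sub_odd o3 odd_one))) hx hP ?_
    have hneg : (E.P r).eval (-x) = -(E.P r).eval x := by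
      rw [P, eval_finsetSum, eval_finsetSum, ← Finset.sum_neg_distrib]
      refine Finset.sum_congr rfl fun l _ => ?_
      simp [edgeTerm_eq, (hall l).neg_pow]
    rw [hneg, hP, neg_zero]
  have hsum : E.P r = E.edgeTerm r .three + (E.edgeTerm r .two +
      (E.edgeTerm r .one + E.edgeTerm r .der)) := by
    rw [← sum_vertex, P, hT]
    rfl
  rw [hsum, edgeTerm_eq, edgeTerm_eq, edgeTerm_eq, edgeTerm_eq]
  exact encard_nonzero_roots_quadrinomial_le (E.edgeCoeff_ne_zero hr _)
    (E.edgeCoeff_ne_zero hr _) (E.edgeCoeff_ne_zero hr _) (E.edgeCoeff_ne_zero hr _)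
    h3 h2 h1 hodd

theorem S_le : E.S ≤ {p | E.IsDenominator p}.encard := by
  have : E.solutions ⊆ (fun p => (algebraMap ℝ[X] (RatFunc ℝ) p)⁻¹) '' {p | E.IsDenominator p} := by
    intro x hx
    obtain ⟨p, hp, rfl⟩ := (E.mem_solutions_iff x).mp hx
    exact ⟨p, hp, rfl⟩
  exact (Set.encard_le_encard this).trans (Set.encard_image_le _ _)

theorem mem_GamSol_iff (d : ℕ) : d ∈ E.GamSol ↔ ∃ p, E.IsDenominator p ∧ p.natDegree = d := by
  constructor
  · rintro ⟨p, hp, hd⟩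
    obtain ⟨q, hq, h⟩ := (E.mem_solutions_iff _).mp hp
    rw [IsFractionRing.injective ℝ[X] (RatFunc ℝ) (inv_injective h)] at hd
    exact ⟨q, hq, hd⟩
  · rintro ⟨p, hp, hd⟩
    exact ⟨p, (E.mem_solutions_iff _).mpr ⟨p, hp, rfl⟩, hd⟩

theorem exists_isGreatest_GamSol (h : E.GamSol.Nonempty) : ∃ r, IsGreatest E.GamSol r := by
  have hb : BddAbove E.GamSol := by
    refine ⟨E.A₃.natDegree, fun d hd => ?_⟩
    obtain ⟨p, hp, rfl⟩ := (E.mem_GamSol_iff d).mp hd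
    have h3 := E.n₂_lt_n₃
    exact (Nat.le_mul_of_pos_left _ (by omega)).trans hp.mul_natDegree_le
  exact ⟨sSup E.GamSol, Nat.sSup_mem h hb, fun d hd => le_csSup hb hd⟩

theorem S_le_of_three_mem (hND : E.ND) {r : ℕ} (hr : IsGreatest E.GamSol r)
    (h : Vertex.three ∈ E.T r) : E.S ≤ {x : ℝ | x ≠ 0 ∧ (E.P r).eval x = 0}.encard := by
  refine E.S_le.trans (le_trans (Set.encard_le_encard ?_) (E.encard_denominators_le hND r))
  intro p hp
  refine ⟨hp, ?_⟩
  by_contra hne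
  have hlt : p.natDegree < r :=
    lt_of_le_of_ne (hr.2 ((E.mem_GamSol_iff _).mpr ⟨p, hp, rfl⟩)) hne
  have h2 := (show E.IsDenominator p from hp).edgeAdmissible.2
  rw [E.T_eq_of_three_mem hlt h, Finset.card_singleton] at h2
  omega

theorem S_le_of_two_mem (hND : E.ND) {r : ℕ} (hr : IsGreatest E.GamSol r)
    (h : Vertex.two ∈ E.T r) : E.S ≤ {x : ℝ | x ≠ 0 ∧ (E.P r).eval x = 0}.encard + 2 := by
  have hlow : {p | E.IsDenominator p ∧ p.natDegree < r}.encard ≤ 2 := by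
    rcases Set.eq_empty_or_nonempty {p | E.IsDenominator p ∧ p.natDegree < r} with he | ⟨q, hq, hqr⟩
    · simp [he]
    · have hTq := E.T_eq_of_two_mem hqr h hq.edgeAdmissible
      refine le_trans (Set.encard_le_encard ?_) ((E.encard_denominators_le hND q.natDegree).trans
        (E.encard_roots_le_two hq.natDegree_pos hTq E.n₂_lt_n₃))
      rintro p ⟨hp, hpr⟩
      exact ⟨hp, E.eq_of_T_eq (E.T_eq_of_two_mem hpr h hp.edgeAdmissible) hTq⟩
  refine E.S_le.trans (le_trans (Set.encard_le_encard
    (t := E.denominators r ∪ {p | E.IsDenominator p ∧ p.natDegree < r}) ?_)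
    ((Set.encard_union_le _ _).trans (add_le_add (E.encard_denominators_le hND r) hlow)))
  intro p hp
  rcases (hr.2 ((E.mem_GamSol_iff _).mpr ⟨p, hp, rfl⟩)).lt_or_eq with hlt | heq
  · exact Or.inr ⟨hp, hlt⟩
  · exact Or.inl ⟨hp, heq⟩

/-- Each alternative locates the minimum among `2, 1, ∂`; admissibility prevents `3` from being the
sole minimizer, and nonresonance excludes the pairs `{2, ∂}` and `{1, ∂}`. -/
theorem T_of_alternatives {r : ℕ} (hadm : E.EdgeAdmissible r) (nd2 : E.ND2 r) {x : ℝ} (hx : x ≠ 0)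
    (hP : (E.P r).eval x = 0) :
    (E.C1 r → E.T r = {Vertex.three, Vertex.two, Vertex.der}) ∧
    (E.C2 r → E.T r = {Vertex.two, Vertex.one} ∨
      E.T r = {Vertex.three, Vertex.two, Vertex.one}) ∧
    (E.C3 r → E.T r = {Vertex.two, Vertex.one, Vertex.der} ∨
      E.T r = {Vertex.three, Vertex.one, Vertex.der} ∨
      E.T r = {Vertex.three, Vertex.two, Vertex.one, Vertex.der}) := by
  have hmem (l : Vertex) : l ∈ E.T r ↔ E.Phi l r ≤ E.Phi .three r ∧ E.Phi l r ≤ E.Phi .two r ∧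
      E.Phi l r ≤ E.Phi .one r ∧ E.Phi l r ≤ E.Phi .der r := by
    rw [mem_T_iff]
    constructor
    · exact fun h => ⟨h _, h _, h _, h _⟩
    · rintro ⟨h3, h2, h1, hd⟩ k
      cases k <;> assumption
  have h3 : E.Phi .two r ≤ E.Phi .three r ∨ E.Phi .one r ≤ E.Phi .three r ∨
      E.Phi .der r ≤ E.Phi .three r := by
    obtain ⟨l, hl, hne⟩ := Finset.exists_mem_ne hadm.2 Vertex.three
    have := ((hmem l).mp hl).1
    cases l <;> tauto
  have n2 := E.T_ne_pair_der nd2 hx hP hadm.1 (l := .two) (by decide)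
  have n1 := E.T_ne_pair_der nd2 hx hP hadm.1 (l := .one) (by decide)
  have p2 : E.Phi .two r = E.n₂ * r - E.A₂.natDegree := rfl
  have p1 : E.Phi .one r = E.n₁ * r - E.A₁.natDegree := rfl
  have pd : E.Phi .der r = r + 1 := by simp [Phi, n, a]
  refine ⟨?_, ?_, ?_⟩
  · rintro ⟨c1, c2⟩
    rw [sub_mul] at c1 c2
    by_cases h : E.Phi .three r = r + 1
    · ext l
      rw [hmem]
      cases l <;> simp <;> omega
    · refine absurd ?_ n2
      ext l
      rw [hmem]
      cases l <;> simp <;> omega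
  · rintro ⟨c1, c2⟩
    rw [sub_mul] at c1 c2
    by_cases h : E.Phi .three r = E.Phi .two r
    · right
      ext l
      rw [hmem]
      cases l <;> simp <;> omega
    · left
      ext l
      rw [hmem]
      cases l <;> simp <;> omega
  · rintro ⟨c1, c2⟩
    rw [sub_mul] at c1 c2
    by_cases h : E.Phi .three r = r + 1
    · right
      by_cases h' : E.Phi .two r = r + 1
      · right
        ext l
        rw [hmem]
        cases l <;> simp <;> omega
      · left
        ext l
        rw [hmem]
        cases l <;> simp <;> omega
    · by_cases h' : E.Phi .two r = r + 1
      · left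
        ext l
        rw [hmem]
        cases l <;> simp <;> omega
      · refine absurd ?_ n1
        ext l
        rw [hmem]
        cases l <;> simp <;> omega

end AbelEquation

theorem corollary6p4 (E : AbelEquation) (hND : E.ND) (htwo : 2 ≤ E.S) :
    (∃ r : ℕ, IsGreatest E.GamSol r ∧
      (E.C1 r → E.T r = {Vertex.three, Vertex.two, Vertex.der} ∧ E.S ≤ 4) ∧
      (E.C2 r → E.T r = {Vertex.two, Vertex.one} → E.S ≤ 5) ∧
      (E.C2 r → E.T r = {Vertex.three, Vertex.two, Vertex.one} → E.S ≤ 4) ∧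
      (E.C3 r → E.T r = {Vertex.two, Vertex.one, Vertex.der} → E.S ≤ 12) ∧
      (E.C3 r → E.T r = {Vertex.three, Vertex.one, Vertex.der} → E.S ≤ 4) ∧
      (E.C3 r → E.T r = {Vertex.three, Vertex.two, Vertex.one, Vertex.der} → E.S ≤ 5)) ∧
    E.S ≤ 12 := by
  have h1 := E.one_lt_n₁
  have h2 := E.n₁_lt_n₂
  have h3 := E.n₂_lt_n₃
  obtain ⟨x, y, hx, hy, hxy⟩ := Set.one_lt_encard_iff.mp
    (lt_of_lt_of_le (by norm_num : (1 : ℕ∞) < 2) htwo)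
  obtain ⟨u, hu, rfl⟩ := (E.mem_solutions_iff _).mp hx
  obtain ⟨v, hv, rfl⟩ := (E.mem_solutions_iff _).mp hy
  have huv : u ≠ v := fun h => hxy (by rw [h])
  obtain ⟨r, hr⟩ := E.exists_isGreatest_GamSol ⟨_, (E.mem_GamSol_iff _).mpr ⟨u, hu, rfl⟩⟩
  obtain ⟨p, hp, rfl⟩ := (E.mem_GamSol_iff _).mp hr.1
  -- A second solution, of any degree, is what the alternatives compare `p` with; this is where `2 ≤
  -- E.S` enters.
  obtain ⟨q, hq, hpq⟩ : ∃ q, E.IsDenominator q ∧ p ≠ q := by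
    by_cases h : p = u
    · exact ⟨v, hv, fun h' => huv (h ▸ h')⟩
    · exact ⟨u, hu, h⟩
  have halt := hp.alternatives hND hq hpq (hr.2 ((E.mem_GamSol_iff _).mpr ⟨q, hq, rfl⟩))
  obtain ⟨-, nd2, nd3⟩ := hND _ hp.mem_Gam hp.edgeAdmissible
  have hlc : p.leadingCoeff⁻¹ ≠ 0 := inv_ne_zero (leadingCoeff_ne_zero.mpr hp.ne_zero)
  obtain ⟨t1, t2, t3⟩ := E.T_of_alternatives hp.edgeAdmissible nd2 hlc hp.eval_P
  have hpos := hp.natDegree_pos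
  have b32d (hT : E.T p.natDegree = {Vertex.three, Vertex.two, Vertex.der}) : E.S ≤ 4 :=
    (E.S_le_of_three_mem hND hr (by simp [hT])).trans
      (E.encard_roots_le_four hpos hT h3 (h1.trans h2))
  have b21 (hT : E.T p.natDegree = {Vertex.two, Vertex.one}) : E.S ≤ 4 :=
    (E.S_le_of_two_mem hND hr (by simp [hT])).trans
      ((add_le_add_left (E.encard_roots_le_two hpos hT h2) 2).trans (by norm_num))
  have b321 (hT : E.T p.natDegree = {Vertex.three, Vertex.two, Vertex.one}) : E.S ≤ 4 :=
    (E.S_le_of_three_mem hND hr (by simp [hT])).trans (E.encard_roots_le_four hpos hT h3 h2)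
  have b21d (hT : E.T p.natDegree = {Vertex.two, Vertex.one, Vertex.der}) : E.S ≤ 6 :=
    (E.S_le_of_two_mem hND hr (by simp [hT])).trans
      ((add_le_add_left (E.encard_roots_le_four hpos hT h2 h1) 2).trans (by norm_num))
  have b31d (hT : E.T p.natDegree = {Vertex.three, Vertex.one, Vertex.der}) : E.S ≤ 4 :=
    (E.S_le_of_three_mem hND hr (by simp [hT])).trans
      (E.encard_roots_le_four hpos hT (h2.trans h3) h1)
  have b321d (hT : E.T p.natDegree = {Vertex.three, Vertex.two, Vertex.one, Vertex.der}) :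
      E.S ≤ 5 :=
    (E.S_le_of_three_mem hND hr (by simp [hT])).trans
      (E.encard_roots_le_five hpos nd3 hT hlc hp.eval_P)
  have l4 : (4 : ℕ∞) ≤ 5 := by norm_num
  have l4' : (4 : ℕ∞) ≤ 12 := by norm_num
  have l5 : (5 : ℕ∞) ≤ 12 := by norm_num
  have l6 : (6 : ℕ∞) ≤ 12 := by norm_num
  refine ⟨⟨_, hr, fun c => ⟨t1 c, b32d (t1 c)⟩, fun _ hT => (b21 hT).trans l4,
    fun _ hT => b321 hT, fun _ hT => (b21d hT).trans l6, fun _ hT => b31d hT,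
    fun _ hT => b321d hT⟩, ?_⟩
  rcases halt with c | c | c
  · exact (b32d (t1 c)).trans l4'
  · rcases t2 c with hT | hT
    · exact (b21 hT).trans l4'
    · exact (b321 hT).trans l4'
  · rcases t3 c with hT | hT | hT
    · exact (b21d hT).trans l6
    · exact (b31d hT).trans l4'
    · exact (b321d hT).trans l5
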